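/- Let $T\ge 0$, $F_0,\dots,F_{T-1}\in\mathbb R^{n_x\times n_x}$, $H_0,\dots,H_T\in\mathbb R^{n_z\times n_x}$, $z_0,\dots,z_T\in\mathbb R^{n_z}$. For $t=0,\dots,T$ let $f_t:\mathbb R^{n_x}\to(-\infty,\infty]$ and $g_t:\mathbb R^{n_z}\to(-\infty,\infty]$ be proper, convex and piecewise linear-quadratic (that is, the set where the function is finite is a union of finitely many polyhedral sets, on each of which the function is a polynomial of degree at most two). Consider the estimation problem $$(\mathcal P)\qquad \min_{x,w}\ \sum_{t=0}^T f_t(w_t)+\sum_{t=0}^T g_t(z_t-H_tx_t)\quad\text{s.t. } x_0=w_0,\ x_{t+1}=F_tx_t+w_{t+1}\ (0\le t<T),$$ and the control problem $$(\mathcal D)\qquad \max_{y,u}\ \sum_{t=0}^T \bigl(z_t^{\top}u_t-f_t^*(y_t)-g_t^*(u_t)\bigr)\quad\text{s.t. } y_T=H_T^{\top}u_T,\ y_t=F_t^{\top}y_{t+1}+H_t^{\top}u_t\ (0\le t<T),$$ where $\varphi^*(y)=\sup_x\{\langle x,y\rangle-\varphi(x)\}$. A problem is called feasible if some point satisfying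 its constraints has objective value $\neq+\infty$ (for $\mathcal P$), respectively $\neq-\infty$ (for $\mathcal D$). If $(\mathcal P)$ or $(\mathcal D)$ is feasible, then, with no constraint qualification, strong duality holds: the optimal values of $(\mathcal P)$ and $(\mathcal D)$ are equal in $[-\infty,\infty]$. If this common value is finite, both problems attain it. In particular, if all $e^{-f_t}$ and $e^{-g_t}$ are (up to positive normalizing constants) probability densities and $(\mathcal P)$ is feasible, then the common value is finite and both problems attain it. -/

import Mathlib

open Matrix MeasureTheory

noncomputable section

/-- A function with values in the extended reals is convex if its epigraph is a convex set. -/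
def ConvexFn {n : ℕ} (φ : (Fin n → ℝ) → EReal) : Prop :=
  Convex ℝ {p : (Fin n → ℝ) × ℝ | φ p.1 ≤ (p.2 : EReal)}

/-- A function with values in the extended reals is proper if it never takes the value `-∞`
and is not identically `+∞`. -/
def ProperFn {n : ℕ} (φ : (Fin n → ℝ) → EReal) : Prop :=
  (∀ x, φ x ≠ ⊥) ∧ ∃ x, φ x ≠ ⊤

/-- The solution set of finitely many (possibly zero) weak linear inequalities. -/
def IsPolyhedralSet {n : ℕ} (C : Set (Fin n → ℝ)) : Prop :=
  ∃ (m : ℕ) (B : Matrix (Fin m) (Fin n) ℝ) (b : Fin m → ℝ), C = {x | B *ᵥ x ≤ b}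

/-- On `C` the function `φ` agrees with a polynomial of degree at most two. -/
def IsLinearQuadraticOn {n : ℕ} (φ : (Fin n → ℝ) → EReal) (C : Set (Fin n → ℝ)) : Prop :=
  ∃ (A : Matrix (Fin n) (Fin n) ℝ) (a : Fin n → ℝ) (α : ℝ), A.IsSymm ∧
    ∀ x ∈ C, φ x = (((1 / 2 : ℝ) * (x ⬝ᵥ A *ᵥ x) + a ⬝ᵥ x + α : ℝ) : EReal)

/-- Piecewise linear-quadratic: the set where `φ < +∞` is a union of finitely many polyhedral
sets, relative to each of which `φ` is linear-quadratic. -/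
def IsPLQ {n : ℕ} (φ : (Fin n → ℝ) → EReal) : Prop :=
  ∃ (k : ℕ) (C : Fin k → Set (Fin n → ℝ)),
    (∀ i, IsPolyhedralSet (C i)) ∧ {x | φ x < ⊤} = ⋃ i, C i ∧
      ∀ i, IsLinearQuadraticOn φ (C i)

/-- The convex conjugate `φ*(y) = sup_x (⟨x, y⟩ - φ x)`. -/
def conjugateFn {n : ℕ} (φ : (Fin n → ℝ) → EReal) (y : Fin n → ℝ) : EReal :=
  ⨆ x : Fin n → ℝ, ((x ⬝ᵥ y : ℝ) : EReal) - φ x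

/-- `e^{-φ}` (with `e^{-∞} = 0`) is, up to a positive normalizing constant, a probability density
with respect to Lebesgue measure. -/
def IsDensityPenalty {n : ℕ} (φ : (Fin n → ℝ) → EReal) : Prop :=
  (∫⁻ x, EReal.exp (-φ x)) ≠ 0 ∧ (∫⁻ x, EReal.exp (-φ x)) ≠ ⊤

/-- The data shared by the estimation problem and the control problem with time horizon `T`:
dynamics `F t`, measurement matrices `H t`, measurements `z t`, and penalties `f t`, `g t` on the
dynamical noise and on the measurement noise. -/
structure EstimationData (T nx nz : ℕ) where
  F : Fin T → Matrix (Fin nx) (Fin nx) ℝ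
  H : Fin (T + 1) → Matrix (Fin nz) (Fin nx) ℝ
  z : Fin (T + 1) → Fin nz → ℝ
  f : Fin (T + 1) → (Fin nx → ℝ) → EReal
  g : Fin (T + 1) → (Fin nz → ℝ) → EReal

namespace EstimationData

variable {T nx nz : ℕ} (S : EstimationData T nx nz)

/-- State equations: `x_0 = w_0` and `x_{t+1} = F_t x_t + w_{t+1}` for `t = 0, …, T - 1`. -/
def StateEq (x w : Fin (T + 1) → Fin nx → ℝ) : Prop :=
  x 0 = w 0 ∧ ∀ t : Fin T, x t.succ = S.F t *ᵥ x t.castSucc + w t.succ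

/-- Objective of the estimation problem: `∑ f_t(w_t) + ∑ g_t(z_t - H_t x_t)`. -/
def estimationCost (x w : Fin (T + 1) → Fin nx → ℝ) : EReal :=
  (∑ t, S.f t (w t)) + ∑ t, S.g t (S.z t - S.H t *ᵥ x t)

/-- Optimal value of the estimation problem (a minimization). -/
def estimationValue : EReal :=
  ⨅ (x : Fin (T + 1) → Fin nx → ℝ) (w : Fin (T + 1) → Fin nx → ℝ) (_ : S.StateEq x w),
    S.estimationCost x w

/-- Some choice satisfying the constraints has an objective value other than `+∞`. -/
def EstimationFeasible : Prop :=
  ∃ x w, S.StateEq x w ∧ S.estimationCost x w < ⊤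

/-- Some choice satisfying the constraints has the optimal value as its objective value. -/
def EstimationAttained : Prop :=
  ∃ x w, S.StateEq x w ∧ S.estimationCost x w = S.estimationValue

/-- Backward equations: `y_T = H_T' u_T` and `y_t = F_t' y_{t+1} + H_t' u_t` for
`t = 0, …, T - 1`. -/
def AdjointEq (y : Fin (T + 1) → Fin nx → ℝ) (u : Fin (T + 1) → Fin nz → ℝ) : Prop :=
  y (Fin.last T) = (S.H (Fin.last T))ᵀ *ᵥ u (Fin.last T) ∧
    ∀ t : Fin T, y t.castSucc = (S.F t)ᵀ *ᵥ y t.succ + (S.H t.castSucc)ᵀ *ᵥ u t.castSucc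

/-- Objective of the control problem: `∑ (z_t' u_t - f_t*(y_t) - g_t*(u_t))`. -/
def controlReward (y : Fin (T + 1) → Fin nx → ℝ) (u : Fin (T + 1) → Fin nz → ℝ) : EReal :=
  ∑ t, (((S.z t ⬝ᵥ u t : ℝ) : EReal) - conjugateFn (S.f t) (y t) - conjugateFn (S.g t) (u t))

/-- Optimal value of the control problem (a maximization). -/
def controlValue : EReal :=
  ⨆ (y : Fin (T + 1) → Fin nx → ℝ) (u : Fin (T + 1) → Fin nz → ℝ) (_ : S.AdjointEq y u),
    S.controlReward y u

/-- Some choice satisfying the constraints has an objective value other than `-∞`. -/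
def ControlFeasible : Prop :=
  ∃ y u, S.AdjointEq y u ∧ ⊥ < S.controlReward y u

/-- Some choice satisfying the constraints has the optimal value as its objective value. -/
def ControlAttained : Prop :=
  ∃ y u, S.AdjointEq y u ∧ S.controlReward y u = S.controlValue

end EstimationData

end

/-!
Both problems are instances of one Fenchel pair. Writing `x` for the trajectory, the estimation
problem minimizes a separable function `∑ i, φ i` over an affine space `b + range M`: the `φ i` are
the penalties `f t` and `g t`, and the noise is eliminated by the state equations. The dual problem
maximizes `∑ i (⟨b i, u i⟩ - (φ i)*(u i))` over the `u` that annihilate `range M`, and summation by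
parts in time (`EstimationData.sum_blockPair_dotProduct_blockMap`) shows that this condition is the
backward equation of the control problem. Weak duality is the Fenchel–Young inequality.

No constraint qualification is needed because every set that has to be closed is a finite union of
linear images of polyhedra. The tool behind this is the Frank–Wolfe theorem
(`IsPolyhedral.exists_isMinOn_quadratic`): a quadratic function bounded below on a nonempty
polyhedron attains its minimum. It gives the following.

* A linear image of a polyhedron is closed (`IsPolyhedral.isClosed_image`), by minimizing the squared
  distance to a given point.
* A feasible primal problem with finite value attains it (`exists_isMin_of_bddBelow`), by minimizing
  over each of the finitely many choices of pieces.
* At a minimizer there are subgradients of the `φ i` that annihilate `range M`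
  (`exists_subgradient_of_isMin`). To first order each `φ i` is described by the cones of feasible
  directions of its pieces, paired with the derivatives of their polynomials. All these cones and
  `range M` together span a closed convex cone, which misses `(0, -1)` by convexity and optimality,
  so a separating functional provides the subgradients. They solve the dual problem with the primal
  value.
* If the primal problem is infeasible, then `b` is strictly separated from the sum of the domain and
  `range M` (`exists_separation_of_infeasible`). From a feasible dual point the dual reward tends to
  `+∞` along the separating functional, so that both values are `+∞`.

Finally, a convex `φ` whose exponential `e^{-φ}` has a finite nonzero integral is bounded below
(`IsDensityPenalty.exists_le`), which makes the primal value finite.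
-/

open Filter Topology

/-! ### Polyhedra and quadratic functions -/

/-- A subset of a real vector space cut out by finitely many weak linear inequalities. Unlike
`IsPolyhedralSet` it does not refer to coordinates, and the inequalities have any finite index
type. -/
def IsPolyhedral {E : Type*} [AddCommGroup E] [Module ℝ E] (C : Set E) : Prop :=
  ∃ (κ : Type) (_ : Finite κ) (l : κ → E →ₗ[ℝ] ℝ) (c : κ → ℝ), C = {x | ∀ j, l j x ≤ c j}

/-- A polynomial function of degree at most two. The bilinear form need not be symmetric. -/
def IsQuadratic {E : Type*} [AddCommGroup E] [Module ℝ E] (q : E → ℝ) : Prop :=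
  ∃ (B : E →ₗ[ℝ] E →ₗ[ℝ] ℝ) (l : E →ₗ[ℝ] ℝ) (c : ℝ), ∀ x, q x = B x x + l x + c

section Algebra

variable {E X : Type*} [AddCommGroup E] [Module ℝ E] [AddCommGroup X] [Module ℝ X]

theorem IsPolyhedral.preimage_affine {C : Set E} (hC : IsPolyhedral C) (b : E) (M : X →ₗ[ℝ] E) :
    IsPolyhedral {x | b + M x ∈ C} := by
  obtain ⟨κ, hκ, l, c, rfl⟩ := hC
  refine ⟨κ, hκ, fun j => l j ∘ₗ M, fun j => c j - l j b, ?_⟩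
  ext x
  simp [le_sub_iff_add_le']

theorem IsPolyhedral.preimage {C : Set E} (hC : IsPolyhedral C) (M : X →ₗ[ℝ] E) :
    IsPolyhedral {x | M x ∈ C} := by
  simpa using hC.preimage_affine 0 M

theorem IsPolyhedral.forall_mem {ι : Type} [Finite ι] {C : ι → Set E}
    (hC : ∀ i, IsPolyhedral (C i)) : IsPolyhedral {x | ∀ i, x ∈ C i} := by
  choose κ hκ l c h using hC
  refine ⟨Σ i, κ i, inferInstance, fun j => l j.1 j.2, fun j => c j.1 j.2, ?_⟩
  ext x
  simp [h, Sigma.forall]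

theorem IsQuadratic.comp_affine {q : E → ℝ} (hq : IsQuadratic q) (b : E) (M : X →ₗ[ℝ] E) :
    IsQuadratic fun x => q (b + M x) := by
  obtain ⟨B, l, c, h⟩ := hq
  refine ⟨B.compl₁₂ M M, (B b + B.flip b + l) ∘ₗ M, B b b + l b + c, fun x => ?_⟩
  simp [h]
  ring

theorem IsQuadratic.sum {ι : Type*} [Fintype ι] {q : ι → E → ℝ} (hq : ∀ i, IsQuadratic (q i)) :
    IsQuadratic fun x => ∑ i, q i x := by
  choose B l c h using hq
  refine ⟨∑ i, B i, ∑ i, l i, ∑ i, c i, fun x => ?_⟩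
  simp [h, Finset.sum_add_distrib]

/-- Expansion of a quadratic function along lines through `x`; the functional `a` is its
derivative at `x`. -/
theorem IsQuadratic.exists_expansion {q : E → ℝ} (hq : IsQuadratic q) (x : E) :
    ∃ (a : E →ₗ[ℝ] ℝ) (Q : E → ℝ), ∀ (t : ℝ) (d : E),
      q (x + t • d) = q x + t * a d + t ^ 2 * Q d := by
  obtain ⟨B, l, c, h⟩ := hq
  refine ⟨B x + B.flip x + l, fun d => B d d, fun t d => ?_⟩
  simp [h]
  ring

end Algebra

/-! ### The Frank–Wolfe theorem -/

section FrankWolfe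

variable {E : Type*} [NormedAddCommGroup E] [NormedSpace ℝ E] [FiniteDimensional ℝ E]

theorem IsPolyhedral.isClosed {C : Set E} (hC : IsPolyhedral C) : IsClosed C := by
  obtain ⟨κ, hκ, l, c, rfl⟩ := hC
  simp only [Set.ofPred_forall]
  exact isClosed_iInter fun j =>
    isClosed_le (LinearMap.continuous_of_finiteDimensional (l j)) continuous_const

theorem continuous_bilin_diag (B : E →ₗ[ℝ] E →ₗ[ℝ] ℝ) : Continuous fun x => B x x := by
  let B' : E →L[ℝ] E →L[ℝ] ℝ :=
    LinearMap.toContinuousLinearMap (LinearMap.toContinuousLinearMap.toLinearMap ∘ₗ B)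
  have : (fun x => B x x) = fun x => B' x x := by
    ext x; simp [B']
  rw [this]
  fun_prop

theorem IsQuadratic.continuous {q : E → ℝ} (hq : IsQuadratic q) : Continuous q := by
  obtain ⟨B, l, c, h⟩ := hq
  rw [funext h]
  exact ((continuous_bilin_diag B).add (LinearMap.continuous_of_finiteDimensional l)).add
    continuous_const

/-- The key step of the Frank–Wolfe theorem. If points `x k` of a polyhedron tend to infinity with
direction `d` while `q` stays bounded along them and `q` is bounded below on the polyhedron, then
moving back from `x k` by `d` stays in the polyhedron, does not increase `q`, and decreases the
norm. -/
theorem exists_shorter_of_tendsto_direction {C : Set E} (hC : IsPolyhedral C) {q : E → ℝ}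
    (hq : IsQuadratic q) {m m' : ℝ} (hm : ∀ y ∈ C, m ≤ q y) {x : ℕ → E} (hxC : ∀ k, x k ∈ C)
    (hxm : ∀ k, q (x k) ≤ m') (hx : Tendsto (fun k => ‖x k‖) atTop atTop) {d : E}
    (hd : Tendsto (fun k => ‖x k‖⁻¹ • x k) atTop (𝓝 d)) :
    ∃ k, x k - d ∈ C ∧ q (x k - d) ≤ q (x k) ∧ ‖x k - d‖ < ‖x k‖ := by
  obtain ⟨κ, hκ, l, c, rfl⟩ := hC
  obtain ⟨B, a, e, h⟩ := hq
  have hinv : Tendsto (fun k => ‖x k‖⁻¹) atTop (𝓝 0) := tendsto_inv_atTop_zero.comp hx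
  have hpos : ∀ᶠ k in atTop, 0 < ‖x k‖ := hx.eventually_gt_atTop 0
  have hld : ∀ j, Tendsto (fun k => ‖x k‖⁻¹ * l j (x k)) atTop (𝓝 (l j d)) := fun j => by
    simpa [Function.comp_def] using
      ((LinearMap.continuous_of_finiteDimensional (l j)).tendsto d).comp hd
  -- `d` is a recession direction of the polyhedron
  have hrec : ∀ j, l j d ≤ 0 := fun j => by
    refine le_of_tendsto_of_tendsto (hld j) (by simpa using hinv.mul_const (c j)) ?_
    filter_upwards with k
    exact mul_le_mul_of_nonneg_left (hxC k j) (by positivity)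
  -- boundedness of `q (x k)` kills the quadratic part in direction `d`
  have hBd : B d d = 0 := by
    have h1 : Tendsto (fun k => ‖x k‖⁻¹ ^ 2 * q (x k)) atTop (𝓝 (B d d)) := by
      have h2 : Tendsto (fun k => B (‖x k‖⁻¹ • x k) (‖x k‖⁻¹ • x k) +
          ‖x k‖⁻¹ * a (‖x k‖⁻¹ • x k) + ‖x k‖⁻¹ ^ 2 * e) atTop (𝓝 (B d d + 0 * a d + 0 ^ 2 * e)) :=
        ((((continuous_bilin_diag B).tendsto d).comp hd).add
          (hinv.mul (((LinearMap.continuous_of_finiteDimensional a).tendsto d).comp hd))).add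
          ((hinv.pow 2).mul_const e)
      simp only [zero_mul, add_zero, ne_eq, OfNat.ofNat_ne_zero, not_false_eq_true, zero_pow] at h2
      refine h2.congr fun k => ?_
      simp [h]
      ring
    have h0 : ∀ r : ℝ, Tendsto (fun k => ‖x k‖⁻¹ ^ 2 * r) atTop (𝓝 0) := fun r => by
      simpa using (hinv.pow 2).mul_const r
    refine tendsto_nhds_unique h1 (tendsto_of_tendsto_of_tendsto_of_le_of_le (h0 m) (h0 m')
      (fun k => ?_) (fun k => ?_))
    · exact mul_le_mul_of_nonneg_left (hm _ (hxC k)) (by positivity)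
    · exact mul_le_mul_of_nonneg_left (hxm k) (by positivity)
  have hline : ∀ (y : E) (t : ℝ), q (y + t • d) = q y + t * (B y d + B d y + a d) := fun y t => by
    simp [h, hBd]
    ring
  -- otherwise `q` would be unbounded below on the ray from `x k` in direction `d`
  have hslope : ∀ k, 0 ≤ B (x k) d + B d (x k) + a d := fun k => by
    by_contra! hneg
    set s := B (x k) d + B d (x k) + a d
    have hs : ∀ t : ℝ, 0 ≤ t → m ≤ q (x k) + t * s := fun t ht => by
      rw [← hline]
      refine hm _ fun j => ?_
      have := mul_nonpos_of_nonneg_of_nonpos ht (hrec j)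
      have := hxC k j
      simp only [map_add, map_smul, smul_eq_mul]
      linarith
    have h1 := hs ((q (x k) - m + 1) / (-s))
      (div_nonneg (by linarith [hm _ (hxC k)]) (by linarith))
    rw [div_mul_eq_mul_div, mul_div_assoc, div_neg, div_self hneg.ne] at h1
    linarith
  have hmem : ∀ᶠ k in atTop, ∀ j, l j (x k - d) ≤ c j := by
    rw [eventually_all]
    intro j
    rcases (hrec j).lt_or_eq with hj | hj
    · -- an inequality that is strict along `d` has unbounded slack at `x k`
      have h1 : Tendsto (fun k => ‖x k‖ * (‖x k‖⁻¹ * l j (x k))) atTop atBot :=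
        hx.atTop_mul_neg hj (hld j)
      filter_upwards [h1.eventually_le_atBot (c j + l j d), hpos] with k hk hk0
      rw [mul_inv_cancel_left₀ hk0.ne'] at hk
      simpa using hk
    · filter_upwards with k
      simpa [hj] using hxC k j
  have hnorm : ∀ᶠ k in atTop, ‖x k - d‖ < ‖x k‖ := by
    have h1 : Tendsto (fun k => ‖‖x k‖⁻¹ • x k - d‖) atTop (𝓝 0) := by
      simpa using (hd.sub_const d).norm
    filter_upwards [h1.eventually_lt_const one_pos, hx.eventually_ge_atTop 1] with k hk hk1
    have hk0 : 0 < ‖x k‖ := by linarith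
    have : x k - d = (1 - ‖x k‖⁻¹) • x k + (‖x k‖⁻¹ • x k - d) := by module
    calc ‖x k - d‖ ≤ ‖(1 - ‖x k‖⁻¹) • x k‖ + ‖‖x k‖⁻¹ • x k - d‖ := by
          rw [this]; exact norm_add_le _ _
      _ = (‖x k‖ - 1) + ‖‖x k‖⁻¹ • x k - d‖ := by
          rw [norm_smul, Real.norm_of_nonneg (sub_nonneg.2 (inv_le_one_of_one_le₀ hk1)), sub_mul,
            inv_mul_cancel₀ hk0.ne', one_mul]
      _ < ‖x k‖ := by linarith
  obtain ⟨k, hk1, hk2⟩ := (hmem.and hnorm).exists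
  refine ⟨k, hk1, ?_, hk2⟩
  have := hline (x k) (-1)
  rw [neg_one_smul, ← sub_eq_add_neg] at this
  linarith [hslope k]

/-- **Frank–Wolfe theorem**: a quadratic function that is bounded below on a nonempty polyhedron
attains its minimum there. -/
theorem IsPolyhedral.exists_isMinOn_quadratic {C : Set E} (hC : IsPolyhedral C) (hne : C.Nonempty)
    {q : E → ℝ} (hq : IsQuadratic q) {m : ℝ} (hm : ∀ y ∈ C, m ≤ q y) :
    ∃ x ∈ C, ∀ y ∈ C, q x ≤ q y := by
  have hbdd : BddBelow (q '' C) := ⟨m, by rintro _ ⟨y, hy, rfl⟩; exact hm y hy⟩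
  set μ := sInf (q '' C)
  have hμ : ∀ y ∈ C, μ ≤ q y := fun y hy => csInf_le hbdd ⟨y, hy, rfl⟩
  -- `x k` has minimal norm among the points of `C` whose value is within
  -- `1 / (k + 1)` of the infimum
  have hex : ∀ k : ℕ, ∃ x, (x ∈ C ∧ q x ≤ μ + 1 / ((k : ℝ) + 1)) ∧
      ∀ y ∈ C, q y ≤ μ + 1 / ((k : ℝ) + 1) → ‖x‖ ≤ ‖y‖ := fun k => by
    have hcl : IsClosed {x | x ∈ C ∧ q x ≤ μ + 1 / ((k : ℝ) + 1)} :=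
      hC.isClosed.inter (isClosed_le hq.continuous continuous_const)
    have hn : {x | x ∈ C ∧ q x ≤ μ + 1 / ((k : ℝ) + 1)}.Nonempty := by
      obtain ⟨_, ⟨y, hy, rfl⟩, hlt⟩ := exists_lt_of_csInf_lt (hne.image q)
        (show sInf (q '' C) < μ + 1 / ((k : ℝ) + 1) from lt_add_of_pos_right _ (by positivity))
      exact ⟨y, hy, hlt.le⟩
    have := FiniteDimensional.proper_real E
    obtain ⟨x, hx, hdist⟩ := hcl.exists_infDist_eq_dist hn 0
    refine ⟨x, hx, fun y hy hy' => ?_⟩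
    rw [← dist_zero_left x, ← dist_zero_left y, ← hdist]
    exact Metric.infDist_le_dist_of_mem ⟨hy, hy'⟩
  choose x hx hmin using hex
  have hlim : Tendsto (fun k => q (x k)) atTop (𝓝 μ) := by
    refine tendsto_of_tendsto_of_tendsto_of_le_of_le tendsto_const_nhds
      (by simpa using tendsto_one_div_add_atTop_nhds_zero_nat.const_add μ)
      (fun k => hμ _ (hx k).1) (fun k => (hx k).2)
  have := FiniteDimensional.proper_real E
  by_cases hinf : Tendsto (fun k => ‖x k‖) atTop atTop
  · exfalso
    have hpos : ∀ᶠ k in atTop, 0 < ‖x k‖ := hinf.eventually_gt_atTop 0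
    obtain ⟨d, -, θ, hθ, hd⟩ := (isCompact_closedBall (0 : E) 1).tendsto_subseq
      (x := fun k => ‖x k‖⁻¹ • x k) fun k => by
        rw [mem_closedBall_zero_iff, norm_smul, norm_inv, norm_norm]
        exact inv_mul_le_one
    obtain ⟨k, hk1, hk2, hk3⟩ := exists_shorter_of_tendsto_direction hC hq hμ
      (x := x ∘ θ) (m' := μ + 1) (fun k => (hx _).1)
      (fun k => (hx _).2.trans (by
        have : 1 / (((θ k : ℕ) : ℝ) + 1) ≤ 1 := by
          rw [div_le_one (by positivity)]; linarith [(Nat.cast_nonneg (θ k) : (0 : ℝ) ≤ _)]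
        linarith))
      (hinf.comp hθ.tendsto_atTop) hd
    exact absurd (hmin (θ k) _ hk1 (hk2.trans (hx _).2)) (not_le.2 hk3)
  · -- some subsequence is bounded, and its cluster point is a minimizer
    rw [tendsto_atTop] at hinf
    push Not at hinf
    obtain ⟨R, hR⟩ := hinf
    obtain ⟨p, -, θ, hθ, hp⟩ := (isCompact_closedBall (0 : E) R).tendsto_subseq'
      (x := x) (hR.mono fun k hk => by simpa using hk.le)
    refine ⟨p, hC.isClosed.mem_of_tendsto hp (Eventually.of_forall fun k => (hx _).1), ?_⟩
    have : q p = μ := tendsto_nhds_unique ((hq.continuous.tendsto p).comp hp)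
      (hlim.comp hθ.tendsto_atTop)
    rw [this]
    exact hμ

/-- A linear image of a polyhedron is closed: the distance to a point of the closure is attained by
the Frank–Wolfe theorem. -/
theorem IsPolyhedral.isClosed_image {W : Type*} [NormedAddCommGroup W] [NormedSpace ℝ W]
    [FiniteDimensional ℝ W] {C : Set E} (hC : IsPolyhedral C) (M : E →ₗ[ℝ] W) :
    IsClosed (M '' C) := by
  rw [← closure_subset_iff_isClosed]
  intro y hy
  have hne : C.Nonempty := by
    rcases C.eq_empty_or_nonempty with rfl | h
    · simp at hy
    · exact h
  let e := toEuclidean (E := W)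
  let q : E → ℝ := fun x => inner ℝ (-(e y) + e (M x)) (-(e y) + e (M x))
  have hq : IsQuadratic q :=
    IsQuadratic.comp_affine (q := fun v => inner ℝ v v)
      ⟨innerₗ _, 0, 0, fun v => by simp⟩ (-(e y)) (e.toLinearEquiv.toLinearMap ∘ₗ M)
  obtain ⟨x, hxC, hx⟩ := hC.exists_isMinOn_quadratic hne hq (m := 0)
    fun _ _ => real_inner_self_nonneg
  refine ⟨x, hxC, ?_⟩
  have h0 : q x ≤ 0 := by
    have hcl : closure (M '' C) ⊆ {w | q x ≤ inner ℝ (-(e y) + e w) (-(e y) + e w)} := by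
      refine closure_minimal ?_ (isClosed_le continuous_const (by fun_prop))
      rintro _ ⟨z, hz, rfl⟩
      exact hx z hz
    simpa using hcl hy
  have h1 : -(e y) + e (M x) = 0 := by
    exact inner_self_eq_zero.1 (le_antisymm h0 real_inner_self_nonneg)
  exact e.injective (by rw [neg_add_eq_zero] at h1; exact h1.symm)

end FrankWolfe

/-! ### First-order behaviour of piecewise linear-quadratic functions -/

section Local

theorem IsPolyhedralSet.isPolyhedral {n : ℕ} {C : Set (Fin n → ℝ)} (hC : IsPolyhedralSet C) :
    IsPolyhedral C := by
  obtain ⟨m, B, b, rfl⟩ := hC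
  exact ⟨Fin m, inferInstance, fun j => LinearMap.proj j ∘ₗ B.mulVecLin, b, rfl⟩

theorem IsLinearQuadraticOn.exists_isQuadratic {n : ℕ} {φ : (Fin n → ℝ) → EReal}
    {C : Set (Fin n → ℝ)} (h : IsLinearQuadraticOn φ C) :
    ∃ q : (Fin n → ℝ) → ℝ, IsQuadratic q ∧ ∀ x ∈ C, φ x = (q x : EReal) := by
  obtain ⟨A, a, α, -, h⟩ := h
  refine ⟨_, ⟨(1 / 2 : ℝ) • Matrix.toLinearMap₂' ℝ A, dotProductBilin ℝ ℝ a, α, fun x => ?_⟩, h⟩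
  simp [Matrix.toLinearMap₂'_apply']

theorem IsPLQ.exists_pieces {n : ℕ} {φ : (Fin n → ℝ) → EReal} (h : IsPLQ φ) :
    ∃ (k : ℕ) (C : Fin k → Set (Fin n → ℝ)) (q : Fin k → (Fin n → ℝ) → ℝ),
      (∀ i, IsPolyhedral (C i)) ∧ (∀ i, IsQuadratic (q i)) ∧
      (∀ x, φ x < ⊤ ↔ ∃ i, x ∈ C i) ∧ ∀ i, ∀ x ∈ C i, φ x = (q i x : EReal) := by
  obtain ⟨k, C, hC, hdom, hq⟩ := h
  choose q hq hφ using fun i => (hq i).exists_isQuadratic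
  refine ⟨k, C, q, fun i => (hC i).isPolyhedral, hq, fun x => ?_, hφ⟩
  simpa using Set.ext_iff.1 hdom x

variable {n : ℕ} {φ : (Fin n → ℝ) → EReal}

theorem ConvexFn.le_segment (hφ : ConvexFn φ) {x y : Fin n → ℝ} {r s t : ℝ} (hx : φ x ≤ r)
    (hy : φ y ≤ s) (h0 : 0 ≤ t) (h1 : t ≤ 1) :
    φ ((1 - t) • x + t • y) ≤ (((1 - t) * r + t * s : ℝ) : EReal) :=
  hφ (x := (x, r)) hx (y := (y, s)) hy (sub_nonneg.2 h1) h0 (by ring)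

/-- The upper directional derivative of `φ` at `v`, where `φ` has the value `r`, is at most `s` in
direction `d`. -/
def DirDerivLE (φ : (Fin n → ℝ) → EReal) (v : Fin n → ℝ) (r : ℝ) (d : Fin n → ℝ) (s : ℝ) : Prop :=
  ∀ s' > s, ∀ᶠ δ : ℝ in 𝓝[>] 0, φ (v + δ • d) ≤ ((r + δ * s' : ℝ) : EReal)

theorem DirDerivLE.zero {v : Fin n → ℝ} {r : ℝ} (hv : φ v = r) : DirDerivLE φ v r 0 0 := by
  intro s' hs'
  filter_upwards [self_mem_nhdsWithin] with δ hδ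
  rw [smul_zero, add_zero, hv, EReal.coe_le_coe_iff]
  have := mul_pos (Set.mem_Ioi.1 hδ) hs'
  linarith

/-- Directional derivatives of a convex function are subadditive. -/
theorem DirDerivLE.add (hφ : ConvexFn φ) {v d d' : Fin n → ℝ} {r s s' : ℝ}
    (h : DirDerivLE φ v r d s) (h' : DirDerivLE φ v r d' s') :
    DirDerivLE φ v r (d + d') (s + s') := by
  intro σ hσ
  have h2 : Tendsto (fun δ : ℝ => 2 * δ) (𝓝[>] 0) (𝓝[>] 0) := by
    refine tendsto_nhdsWithin_iff.2 ⟨?_, ?_⟩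
    · have : Tendsto (fun δ : ℝ => 2 * δ) (𝓝 0) (𝓝 (2 * 0)) :=
        Continuous.tendsto (by fun_prop) 0
      rw [mul_zero] at this
      exact this.mono_left nhdsWithin_le_nhds
    · filter_upwards [self_mem_nhdsWithin] with δ hδ
      simpa using hδ
  filter_upwards [h2.eventually (h (s + (σ - s - s') / 2) (by linarith)),
    h2.eventually (h' (s' + (σ - s - s') / 2) (by linarith))] with δ h1 h3
  -- `v + δ (d + d')` is the midpoint of `v + 2 δ d` and `v + 2 δ d'`
  convert hφ.le_segment h1 h3 (t := 1 / 2) (by norm_num) (by norm_num) using 2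
  · module
  · ring

theorem DirDerivLE.sum (hφ : ConvexFn φ) {κ : Type*} (I : Finset κ) {v : Fin n → ℝ} {r : ℝ}
    (hv : φ v = r) {d : κ → Fin n → ℝ} {s : κ → ℝ} (h : ∀ c, DirDerivLE φ v r (d c) (s c)) :
    DirDerivLE φ v r (∑ c ∈ I, d c) (∑ c ∈ I, s c) := by
  classical
  induction I using Finset.induction_on with
  | empty => simpa using DirDerivLE.zero hv
  | insert c I hc ih =>
    rw [Finset.sum_insert hc, Finset.sum_insert hc]
    exact (h c).add hφ ih

/-- First-order model of a convex piecewise linear-quadratic function at a point `v` of its domain.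
Each piece `c` that contains `v` contributes its polyhedral cone `T c` of feasible directions and
the derivative `a c` of its polynomial at `v`. The functionals `a c` bound the directional
derivatives from above, and the function itself from below. -/
theorem IsPLQ.exists_local_model (hplq : IsPLQ φ) (hφ : ConvexFn φ) {v : Fin n → ℝ} {r : ℝ}
    (hv : φ v = r) :
    ∃ (κ : Type) (_ : Fintype κ) (T : κ → Set (Fin n → ℝ)) (a : κ → (Fin n → ℝ) →ₗ[ℝ] ℝ),
      (∀ c, IsPolyhedral (T c)) ∧ (∀ c, 0 ∈ T c) ∧
      (∀ c, ∀ d ∈ T c, ∀ t : ℝ, 0 ≤ t → t • d ∈ T c) ∧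
      (∀ c, ∀ d ∈ T c, DirDerivLE φ v r d (a c d)) ∧
      ∀ d, φ (v + d) < ⊤ → ∃ c, d ∈ T c ∧ ((r + a c d : ℝ) : EReal) ≤ φ (v + d) := by
  classical
  obtain ⟨k, C, q, hC, hq, hdom, hφq⟩ := hplq.exists_pieces
  have hcl := fun i => (hC i).isClosed
  choose J hJ l b hCeq using hC
  choose a Q haQ using fun i => (hq i).exists_expansion v
  have hqv : ∀ i, v ∈ C i → q i v = r := fun i hi => by
    have := hφq i v hi
    rw [hv] at this
    exact (EReal.coe_injective this).symm
  refine ⟨{i // v ∈ C i}, inferInstance, fun c => {d | ∀ j, l c j v = b c j → l c j d ≤ 0},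
    fun c => a c, fun c => ?_, fun c => ?_, fun c d hd t ht => ?_, fun c d hd => ?_, fun d hd => ?_⟩
  · refine ⟨{j // l c j v = b c j}, inferInstance, fun j => l c j, fun _ => 0, ?_⟩
    ext d
    simp
  · simp
  · intro j hj
    simpa using mul_nonpos_of_nonneg_of_nonpos ht (hd j hj)
  · -- inactive constraints stay satisfied for small steps
    have hmem : ∀ᶠ δ : ℝ in 𝓝[>] 0, v + δ • d ∈ C c := by
      have hvc : ∀ j, l c j v ≤ b c j := by
        have := c.2
        rw [hCeq] at this
        exact this
      have : ∀ᶠ δ : ℝ in 𝓝[>] 0, ∀ j, l c j (v + δ • d) ≤ b c j := by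
        rw [eventually_all]
        intro j
        rcases (hvc j).lt_or_eq with hj | hj
        · have ht : Tendsto (fun δ : ℝ => l c j v + δ * l c j d) (𝓝[>] 0)
              (𝓝 (l c j v + 0 * l c j d)) :=
            (Continuous.tendsto (by fun_prop) 0).mono_left nhdsWithin_le_nhds
          filter_upwards [ht.eventually_lt_const (by simpa using hj)] with δ hδ
          simpa using hδ.le
        · filter_upwards [self_mem_nhdsWithin] with δ hδ
          have := mul_nonpos_of_nonneg_of_nonpos (Set.mem_Ioi.1 hδ).le (hd j hj)
          simpa [hj] using this
      rw [hCeq]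
      exact this
    intro s hs
    have ht : Tendsto (fun δ : ℝ => a c d + δ * Q c d) (𝓝[>] 0) (𝓝 (a c d + 0 * Q c d)) :=
      (Continuous.tendsto (by fun_prop) 0).mono_left nhdsWithin_le_nhds
    filter_upwards [hmem, ht.eventually_lt_const (by simpa using hs), self_mem_nhdsWithin]
      with δ h1 h2 h3
    rw [hφq c _ h1, haQ, hqv c c.2, EReal.coe_le_coe_iff]
    have := mul_lt_mul_of_pos_left h2 (Set.mem_Ioi.1 h3)
    linarith
  · -- some piece meets the segment from `v` to `v + d` arbitrarily close to `v`
    obtain ⟨i₀, hi₀⟩ := (hdom _).1 hd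
    have hval := hφq i₀ _ hi₀
    have hseg : ∀ᶠ t : ℝ in 𝓝[>] 0,
        φ (v + t • d) ≤ (((1 - t) * r + t * q i₀ (v + d) : ℝ) : EReal) := by
      filter_upwards [Ioo_mem_nhdsGT one_pos] with t ht
      have := hφ.le_segment hv.le hval.le ht.1.le ht.2.le
      convert this using 2
      module
    have hex : ∃ i, ∃ᶠ t : ℝ in 𝓝[>] 0, v + t • d ∈ C i := by
      by_contra hno
      simp only [not_exists, not_frequently] at hno
      obtain ⟨t, ht1, ht2⟩ := (hseg.and (eventually_all.2 hno)).exists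
      obtain ⟨i, hi⟩ := (hdom _).1 (ht1.trans_lt (EReal.coe_lt_top _))
      exact ht2 i hi
    obtain ⟨i, hi⟩ := hex
    have hlim : Tendsto (fun t : ℝ => v + t • d) (𝓝[>] 0) (𝓝 v) := by
      have : Tendsto (fun t : ℝ => v + t • d) (𝓝 0) (𝓝 (v + (0 : ℝ) • d)) :=
        Continuous.tendsto (by fun_prop) 0
      rw [zero_smul, add_zero] at this
      exact this.mono_left nhdsWithin_le_nhds
    have hvi : v ∈ C i := (hcl i).mem_of_frequently_of_tendsto hi hlim
    refine ⟨⟨i, hvi⟩, fun j hj => ?_, ?_⟩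
    · obtain ⟨t, ht1, ht2⟩ := (hi.and_eventually self_mem_nhdsWithin).exists
      rw [hCeq i] at ht1
      have h1 := ht1 j
      simp only [map_add, map_smul, smul_eq_mul, hj] at h1
      by_contra! hpos
      have := mul_pos (Set.mem_Ioi.1 ht2) hpos
      linarith
    · rw [hval, EReal.coe_le_coe_iff]
      have ht : Tendsto (fun t : ℝ => r + a i d + t * Q i d) (𝓝[>] 0)
          (𝓝 (r + a i d + 0 * Q i d)) :=
        (Continuous.tendsto (by fun_prop) 0).mono_left nhdsWithin_le_nhds
      rw [zero_mul, add_zero] at ht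
      refine le_of_tendsto_of_frequently ht
        ((hi.and_eventually (hseg.and self_mem_nhdsWithin)).mono ?_)
      rintro t ⟨h1, h2, h3⟩
      have h3 : 0 < t := h3
      rw [hφq i _ h1, haQ, hqv i hvi, EReal.coe_le_coe_iff] at h2
      refine le_of_mul_le_mul_left ?_ h3
      nlinarith

end Local

/-! ### Subgradients, separation and minimizers for separable functions -/

section Separation

variable {ι : Type} [Fintype ι] {n : ι → ℕ}

/-- A linear functional on a product of coordinate spaces is given by dot products. -/
theorem exists_dotProduct_of_linearMap [DecidableEq ι] (g : (∀ i, Fin (n i) → ℝ) →ₗ[ℝ] ℝ) :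
    ∃ u : ∀ i, Fin (n i) → ℝ, (∀ i d, g (Pi.single i d) = u i ⬝ᵥ d) ∧
      ∀ v, g v = ∑ i, u i ⬝ᵥ v i := by
  have h : ∀ i d, g (Pi.single i d) =
      (fun k => g (Pi.single i (Pi.single k 1))) ⬝ᵥ (d : Fin (n i) → ℝ) := fun i d => by
    have := (g ∘ₗ LinearMap.single ℝ (fun i => Fin (n i) → ℝ) i).pi_apply_eq_sum_univ d
    simp only [LinearMap.comp_apply, LinearMap.single_apply, smul_eq_mul] at this
    rw [this]
    refine Finset.sum_congr rfl fun k _ => ?_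
    rw [mul_comm]
    congr 4
    ext j
    simp [Pi.single_apply, eq_comm]
  refine ⟨fun i k => g (Pi.single i (Pi.single k 1)), h, fun v => ?_⟩
  conv_lhs => rw [← Finset.univ_sum_single v, map_sum]
  exact Finset.sum_congr rfl fun i _ => h i (v i)

variable {φ : ∀ i, (Fin (n i) → ℝ) → EReal} {X : Type*} [NormedAddCommGroup X] [NormedSpace ℝ X]
  [FiniteDimensional ℝ X]

/-- Subgradients at a minimizer, without constraint qualification: if `v` minimizes the separable
function `∑ i, φ i` over the affine space `v + range M`, then there are subgradients `u i` of `φ i`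
at `v i` that together annihilate the range of `M`. The feasible directions of the pieces, paired
with their derivatives, span together with the range of `M` a closed convex cone. Convexity and
optimality keep `(0, -1)` out of it, and a separating functional gives `u`. -/
theorem exists_subgradient_of_isMin (hφ : ∀ i, ConvexFn (φ i)) (hplq : ∀ i, IsPLQ (φ i))
    {v : ∀ i, Fin (n i) → ℝ} {r : ι → ℝ} (hv : ∀ i, φ i (v i) = r i)
    (M : X →ₗ[ℝ] ∀ i, Fin (n i) → ℝ)
    (hmin : ∀ h : X, ∀ s : ι → ℝ, (∀ i, φ i (v i + M h i) ≤ s i) → ∑ i, r i ≤ ∑ i, s i) :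
    ∃ u : ∀ i, Fin (n i) → ℝ, (∀ h, ∑ i, u i ⬝ᵥ M h i = 0) ∧
      ∀ i d, ((r i + u i ⬝ᵥ d : ℝ) : EReal) ≤ φ i (v i + d) := by
  classical
  choose κ hκ T a hT hT0 hTsmul hTdir hTsub using
    fun i => (hplq i).exists_local_model (hφ i) (hv i)
  let L : (∀ j : Σ i, κ i, Fin (n j.1) → ℝ) × X →ₗ[ℝ] (∀ i, Fin (n i) → ℝ) × ℝ :=
    { toFun := fun p => (fun i => ∑ c, p.1 ⟨i, c⟩ + M p.2 i, ∑ i, ∑ c, a i c (p.1 ⟨i, c⟩))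
      map_add' := fun p p' => by
        ext
        · simp [Finset.sum_add_distrib]; ring
        · simp [Finset.sum_add_distrib]
      map_smul' := fun t p => by
        ext
        · simp [mul_add, ← Finset.mul_sum]
          exact Or.inl (Finset.sum_apply _ _ _).symm
        · simp [Finset.mul_sum] }
  let P : Set ((∀ j : Σ i, κ i, Fin (n j.1) → ℝ) × X) :=
    {p | ∀ j : Σ i, κ i, p ∈ {p : (∀ j : Σ i, κ i, Fin (n j.1) → ℝ) × X | p.1 j ∈ T j.1 j.2}}
  have hP : IsPolyhedral P := IsPolyhedral.forall_mem fun j => (hT j.1 j.2).preimage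
    (LinearMap.proj j ∘ₗ LinearMap.fst ℝ (∀ j : Σ i, κ i, Fin (n j.1) → ℝ) X)
  have hPconv : Convex ℝ P := by
    obtain ⟨J, -, l, c, h⟩ := hP
    rw [h]
    intro p hp p' hp' s t hs ht hst j
    have h1 := mul_le_mul_of_nonneg_left (hp j) hs
    have h2 := mul_le_mul_of_nonneg_left (hp' j) ht
    simp only [map_add, map_smul, smul_eq_mul]
    calc _ ≤ (s + t) * c j := by linarith
      _ = c j := by rw [hst, one_mul]
  have hnot : ((0 : ∀ i, Fin (n i) → ℝ), (-1 : ℝ)) ∉ L '' P := by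
    rintro ⟨p, hp, hLp⟩
    have hL1 : ∀ i, ∑ c, p.1 ⟨i, c⟩ = M (-p.2) i := fun i => by
      have := congrFun (congrArg Prod.fst hLp) i
      rw [map_neg, Pi.neg_apply]
      exact eq_neg_of_add_eq_zero_left this
    have hL2 : ∑ i, ∑ c, a i c (p.1 ⟨i, c⟩) = -1 := congrArg Prod.snd hLp
    have hdir : ∀ i, DirDerivLE (φ i) (v i) (r i) (M (-p.2) i) (∑ c, a i c (p.1 ⟨i, c⟩)) :=
      fun i => by
        rw [← hL1]
        exact DirDerivLE.sum (hφ i) _ (hv i) fun c => hTdir i c _ (hp ⟨i, c⟩)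
    -- the errors `η`, one for each block, do not add up to the total slope `-1`
    obtain ⟨η, hη0, hη⟩ : ∃ η : ℝ, 0 < η ∧ Fintype.card ι * η < 1 :=
      ⟨1 / (Fintype.card ι + 1), by positivity, by
        rw [mul_one_div, div_lt_one (by positivity)]; linarith⟩
    obtain ⟨δ, hδ, hδ0⟩ := ((eventually_all.2 fun i =>
      hdir i (∑ c, a i c (p.1 ⟨i, c⟩) + η) (by linarith)).and self_mem_nhdsWithin).exists
    have hδ0 : 0 < δ := hδ0
    have := hmin (δ • -p.2) _ fun i => by
      rw [map_smul, Pi.smul_apply]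
      exact hδ i
    rw [Finset.sum_add_distrib, ← Finset.mul_sum, Finset.sum_add_distrib, hL2] at this
    simp only [Finset.sum_const, Finset.card_univ, nsmul_eq_mul] at this
    nlinarith
  obtain ⟨f, μ, hfμ, hμ⟩ := geometric_hahn_banach_closed_point (hPconv.linear_image L)
    (hP.isClosed_image L) hnot
  have h0P : (0 : (∀ j : Σ i, κ i, Fin (n j.1) → ℝ) × X) ∈ P := fun j => hT0 j.1 j.2
  have hμ0 : 0 < μ := by simpa using hfμ _ ⟨0, h0P, rfl⟩
  have hfK : ∀ p ∈ P, f (L p) ≤ 0 := fun p hp => by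
    by_contra! hpos
    have h1 := hfμ _ ⟨(μ / f (L p)) • p, fun j => hTsmul _ _ _ (hp j) _ (by positivity), rfl⟩
    rw [map_smul, map_smul, smul_eq_mul, div_mul_cancel₀ _ hpos.ne'] at h1
    exact lt_irrefl _ h1
  set σ := f (0, -1)
  have hσ : 0 < σ := hμ0.trans hμ
  have hfs : ∀ w s, f (w, s) = f (w, 0) - σ * s := fun w s => by
    have : (w, s) = (w, (0 : ℝ)) + (-s) • ((0 : ∀ i, Fin (n i) → ℝ), (-1 : ℝ)) := by ext <;> simp
    rw [this, map_add, map_smul, smul_eq_mul]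
    ring
  obtain ⟨u, hu1, hu⟩ := exists_dotProduct_of_linearMap
    (σ⁻¹ • (f.toLinearMap ∘ₗ LinearMap.inl ℝ (∀ i, Fin (n i) → ℝ) ℝ))
  have hu' : ∀ w, σ * ∑ i, u i ⬝ᵥ w i = f (w, 0) := fun w => by
    rw [← hu]
    simp [mul_inv_cancel_left₀ hσ.ne']
  refine ⟨u, fun h => ?_, fun i d => ?_⟩
  · have hle : ∀ h, f (M h, 0) ≤ 0 := fun h => by
      have := hfK (0, h) fun j => hT0 j.1 j.2
      simpa [L] using this
    have h1 := hle h
    have h2 := hle (-h)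
    rw [← hu'] at h1 h2
    simp only [map_neg, Pi.neg_apply, dotProduct_neg, Finset.sum_neg_distrib] at h2
    have : σ * ∑ i, u i ⬝ᵥ M h i = 0 := by linarith
    exact (mul_eq_zero.1 this).resolve_left hσ.ne'
  · rcases eq_or_ne (φ i (v i + d)) ⊤ with htop | htop
    · rw [htop]; exact le_top
    obtain ⟨c, hc, hle⟩ := hTsub i d (lt_top_iff_ne_top.2 htop)
    refine le_trans ?_ hle
    rw [EReal.coe_le_coe_iff, add_le_add_iff_left]
    have h1 := hfK (Pi.single ⟨i, c⟩ d, 0) fun j => by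
      rcases eq_or_ne j ⟨i, c⟩ with rfl | hj
      · simpa using hc
      · simpa [hj] using hT0 j.1 j.2
    have h2 : L (Pi.single ⟨i, c⟩ d, 0) = (Pi.single i d, a i c d) := by
      ext i' k
      · rcases eq_or_ne i' i with rfl | hi
        · have : ∑ c', (Pi.single ⟨i', c⟩ d : ∀ j : Σ i, κ i, Fin (n j.1) → ℝ) ⟨i', c'⟩ = d := by
            rw [Finset.sum_eq_single c]
            · simp
            · intro c' _ hc'
              simp [hc']
            · simp
          simp only [L, LinearMap.coe_mk, AddHom.coe_mk, this]
          simp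
        · simp [L, hi]
      · have : ∑ j : Σ i, κ i, a j.1 j.2
            ((Pi.single ⟨i, c⟩ d : ∀ j : Σ i, κ i, Fin (n j.1) → ℝ) j) = a i c d := by
          rw [Finset.sum_eq_single ⟨i, c⟩]
          · simp
          · intro j _ hj
            simp [hj]
          · simp
        simpa [L, Fintype.sum_sigma] using this
    rw [h2, hfs, ← hu', ← hu, hu1] at h1
    exact le_of_mul_le_mul_left (by linarith) hσ

/-- If the pairwise independent terms of a sum are jointly bounded, they have individual bounds with
the same total. -/
theorem exists_forall_le_of_forall_sum_le {α : ι → Type*} {A : ∀ i, Set (α i)}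
    (hA : ∀ i, (A i).Nonempty) (h : ∀ i, α i → ℝ) {c : ℝ}
    (hc : ∀ v : ∀ i, α i, (∀ i, v i ∈ A i) → ∑ i, h i (v i) ≤ c) :
    ∃ s : ι → ℝ, (∀ i, ∀ w ∈ A i, h i w ≤ s i) ∧ ∑ i, s i ≤ c := by
  classical
  choose w hw using hA
  have hbdd : ∀ i, BddAbove (h i '' A i) := fun i => by
    refine ⟨c - ∑ j ∈ Finset.univ.erase i, h j (w j), ?_⟩
    rintro _ ⟨x, hx, rfl⟩
    have := hc (Function.update w i x) fun j => by
      rcases eq_or_ne j i with rfl | hj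
      · simpa using hx
      · simpa [hj] using hw j
    rw [← Finset.add_sum_erase _ _ (Finset.mem_univ i), Function.update_self,
      Finset.sum_congr rfl (g := fun j => h j (w j))] at this
    · linarith
    · intro j hj
      rw [Function.update_of_ne (Finset.ne_of_mem_erase hj)]
  refine ⟨fun i => sSup (h i '' A i), fun i x hx => le_csSup (hbdd i) ⟨x, hx, rfl⟩, ?_⟩
  refine le_of_forall_pos_le_add fun ε hε => ?_
  obtain ⟨η, hη0, hη⟩ : ∃ η : ℝ, 0 < η ∧ Fintype.card ι * η ≤ ε :=
    ⟨ε / (Fintype.card ι + 1), by positivity, by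
      rw [mul_div_assoc', div_le_iff₀ (by positivity)]; nlinarith⟩
  have hex : ∀ i, ∃ x ∈ A i, sSup (h i '' A i) - η < h i x := fun i => by
    obtain ⟨_, ⟨x, hx, rfl⟩, hlt⟩ := exists_lt_of_lt_csSup
      ((Set.nonempty_of_mem (hw i)).image (h i)) (sub_lt_self (sSup (h i '' A i)) hη0)
    exact ⟨x, hx, hlt⟩
  choose x hx hlt using hex
  have h1 := Finset.sum_le_sum fun i (_ : i ∈ Finset.univ) => (hlt i).le
  rw [Finset.sum_sub_distrib] at h1
  simp only [Finset.sum_const, Finset.card_univ, nsmul_eq_mul] at h1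
  linarith [hc x hx]

/-- If no point of `b + range M` lies in the domain of the separable function `∑ i, φ i`, then `b` is
strictly separated from that domain by a functional that annihilates the range of `M`: the sum of
the domain and the range is convex and a finite union of linear images of polyhedra, hence closed. -/
theorem exists_separation_of_infeasible (hφ : ∀ i, ConvexFn (φ i)) (hplq : ∀ i, IsPLQ (φ i))
    (hne : ∀ i, ∃ x, φ i x < ⊤) (M : X →ₗ[ℝ] ∀ i, Fin (n i) → ℝ) (b : ∀ i, Fin (n i) → ℝ)
    (hinf : ∀ x, ∃ i, φ i (b i + M x i) = ⊤) :
    ∃ (u : ∀ i, Fin (n i) → ℝ) (s : ι → ℝ), (∀ h, ∑ i, u i ⬝ᵥ M h i = 0) ∧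
      (∀ i w, φ i w < ⊤ → u i ⬝ᵥ w ≤ s i) ∧ ∑ i, s i < ∑ i, u i ⬝ᵥ b i := by
  classical
  choose K C q hC _ hdom hφq using fun i => (hplq i).exists_pieces
  let L : (∀ i, Fin (n i) → ℝ) × X →ₗ[ℝ] ∀ i, Fin (n i) → ℝ := LinearMap.coprod LinearMap.id M
  let P : Set ((∀ i, Fin (n i) → ℝ) × X) := {p | ∀ i, φ i (p.1 i) < ⊤}
  have hPun : P = ⋃ k : ∀ i, Fin (K i),
      {p | ∀ i, p ∈ {p : (∀ i, Fin (n i) → ℝ) × X | p.1 i ∈ C i (k i)}} := by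
    ext p
    simp only [P, Set.mem_ofPred_eq, hdom, Set.mem_iUnion]
    exact ⟨fun h => ⟨fun i => (h i).choose, fun i => (h i).choose_spec⟩,
      fun ⟨k, hk⟩ i => ⟨k i, hk i⟩⟩
  have hclosed : IsClosed (L '' P) := by
    rw [hPun, Set.image_iUnion]
    refine isClosed_iUnion_of_finite fun k => IsPolyhedral.isClosed_image ?_ L
    exact IsPolyhedral.forall_mem fun i =>
      (hC i (k i)).preimage (LinearMap.proj i ∘ₗ LinearMap.fst ℝ (∀ i, Fin (n i) → ℝ) X)
  have hconv : Convex ℝ P := by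
    have hreal : ∀ i x, φ i x < ⊤ → ∃ r : ℝ, φ i x ≤ r := fun i x hx => by
      obtain ⟨j, hj⟩ := (hdom i x).1 hx
      exact ⟨_, (hφq i j x hj).le⟩
    intro p hp p' hp' s t hs ht hst i
    obtain ⟨r, hr⟩ := hreal i _ (hp i)
    obtain ⟨r', hr'⟩ := hreal i _ (hp' i)
    exact lt_of_le_of_lt (hφ i (x := (p.1 i, r)) hr (y := (p'.1 i, r')) hr' hs ht hst)
      (EReal.coe_lt_top _)
  have hb : b ∉ L '' P := by
    rintro ⟨p, hp, hpb⟩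
    obtain ⟨i, hi⟩ := hinf (-p.2)
    have : p.1 i + M p.2 i = b i := congrFun hpb i
    have h1 := hp i
    rw [← this, map_neg, Pi.neg_apply, add_neg_cancel_right] at hi
    exact h1.ne hi
  obtain ⟨f, μ, hfμ, hμ⟩ := geometric_hahn_banach_closed_point (hconv.linear_image L) hclosed hb
  choose w hw using hne
  -- a functional bounded above on a translate of `range M` vanishes on `range M`
  have hfM : ∀ h, f (M h) = 0 := fun h => by
    by_contra hne0
    have h1 := hfμ _ ⟨(w, ((μ - f w) / f (M h)) • h), hw, rfl⟩
    simp [L, div_mul_cancel₀ _ hne0] at h1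
  obtain ⟨u, -, hu⟩ := exists_dotProduct_of_linearMap f.toLinearMap
  obtain ⟨s, hs, hsum⟩ := exists_forall_le_of_forall_sum_le (A := fun i => {w | φ i w < ⊤})
    (fun i => ⟨w i, hw i⟩) (fun i w => u i ⬝ᵥ w) (c := μ) fun v hv => by
      rw [← hu]
      simpa [L] using (hfμ _ ⟨(v, 0), hv, rfl⟩).le
  refine ⟨u, s, fun h => ?_, hs, hsum.trans_lt ?_⟩
  · rw [← hu]; exact hfM h
  · rw [← hu]; exact hμ

/-- A separable piecewise linear-quadratic function that is bounded below on an affine space meeting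
its domain attains its minimum there. -/
theorem exists_isMin_of_bddBelow (hplq : ∀ i, IsPLQ (φ i)) (M : X →ₗ[ℝ] ∀ i, Fin (n i) → ℝ)
    (b : ∀ i, Fin (n i) → ℝ) (hfeas : ∃ x, ∀ i, φ i (b i + M x i) < ⊤) {m : ℝ}
    (hm : ∀ x, ∀ r : ι → ℝ, (∀ i, φ i (b i + M x i) = r i) → m ≤ ∑ i, r i) :
    ∃ (x : X) (r : ι → ℝ), (∀ i, φ i (b i + M x i) = r i) ∧
      ∀ y, ∀ s : ι → ℝ, (∀ i, φ i (b i + M y i) = s i) → ∑ i, r i ≤ ∑ i, s i := by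
  classical
  choose K C q hC hq hdom hφq using fun i => (hplq i).exists_pieces
  let P : (∀ i, Fin (K i)) → Set X := fun k => {x | ∀ i, x ∈ {x | b i + M x i ∈ C i (k i)}}
  let Q : (∀ i, Fin (K i)) → X → ℝ := fun k x => ∑ i, q i (k i) (b i + M x i)
  have hP : ∀ k, IsPolyhedral (P k) := fun k => IsPolyhedral.forall_mem fun i =>
    (hC i (k i)).preimage_affine (b i) (LinearMap.proj i ∘ₗ M)
  have hQ : ∀ k, IsQuadratic (Q k) := fun k => IsQuadratic.sum fun i =>
    (hq i (k i)).comp_affine (b i) (LinearMap.proj i ∘ₗ M)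
  have hmQ : ∀ k, ∀ x ∈ P k, m ≤ Q k x := fun k x hx => hm x _ fun i => hφq i _ _ (hx i)
  have hex : ∀ k : {k // (P k).Nonempty}, ∃ x ∈ P k, ∀ y ∈ P k, Q k x ≤ Q k y := fun k =>
    (hP k).exists_isMinOn_quadratic k.2 (hQ k) (hmQ k)
  choose x hxP hxmin using hex
  have hchoice : ∀ y, (∀ i, φ i (b i + M y i) < ⊤) → ∃ k, y ∈ P k := fun y hy =>
    ⟨fun i => ((hdom i _).1 (hy i)).choose, fun i => ((hdom i _).1 (hy i)).choose_spec⟩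
  obtain ⟨y₀, hy₀⟩ := hfeas
  obtain ⟨k₀, hk₀⟩ := hchoice y₀ hy₀
  have : Nonempty {k // (P k).Nonempty} := ⟨⟨k₀, y₀, hk₀⟩⟩
  obtain ⟨k, hk⟩ := Finite.exists_min fun k : {k // (P k).Nonempty} => Q k (x k)
  refine ⟨x k, fun i => q i (k.1 i) (b i + M (x k) i), fun i => hφq i _ _ (hxP k i),
    fun y s hs => ?_⟩
  obtain ⟨k', hk'⟩ := hchoice y fun i => by rw [hs]; exact EReal.coe_lt_top _
  have h1 : ∑ i, s i = Q k' y := Finset.sum_congr rfl fun i _ => by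
    have := hφq i _ _ (hk' i)
    rw [hs] at this
    exact EReal.coe_injective this
  rw [h1]
  exact (hk ⟨k', y, hk'⟩).trans (hxmin ⟨k', y, hk'⟩ y hk')

end Separation

/-! ### Finite sums of extended reals -/

section ERealSum

variable {ι : Type*} {f : ι → EReal}

theorem ereal_coe_sum [Fintype ι] (r : ι → ℝ) : ((∑ i, r i : ℝ) : EReal) = ∑ i, (r i : EReal) :=
  map_sum (⟨⟨fun x : ℝ => (x : EReal), EReal.coe_zero⟩, EReal.coe_add⟩ : ℝ →+ EReal) _ _

theorem ereal_sum_eq_bot [Fintype ι] {i : ι} (hi : f i = ⊥) : ∑ i, f i = ⊥ := by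
  classical
  rw [← Finset.add_sum_erase _ _ (Finset.mem_univ i), hi, EReal.bot_add]

theorem ereal_sum_ne_bot (s : Finset ι) (h : ∀ i, f i ≠ ⊥) : ∑ i ∈ s, f i ≠ ⊥ :=
  Finset.sum_induction f (· ≠ ⊥) (fun _ _ ha hb => EReal.add_ne_bot_iff.2 ⟨ha, hb⟩)
    EReal.zero_ne_bot fun i _ => h i

theorem ereal_sum_eq_top [Fintype ι] {i : ι} (h : ∀ i, f i ≠ ⊥) (hi : f i = ⊤) : ∑ i, f i = ⊤ := by
  classical
  rw [← Finset.add_sum_erase _ _ (Finset.mem_univ i), hi,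
    EReal.top_add_of_ne_bot (ereal_sum_ne_bot _ h)]

theorem exists_real_of_forall_ne (hb : ∀ i, f i ≠ ⊥) (ht : ∀ i, f i ≠ ⊤) :
    ∃ r : ι → ℝ, ∀ i, f i = r i :=
  ⟨fun i => (f i).toReal, fun i => (EReal.coe_toReal (ht i) (hb i)).symm⟩

end ERealSum

/-! ### Conjugate functions -/

section Conjugate

variable {n : ℕ} {φ : (Fin n → ℝ) → EReal}

theorem ProperFn.conjugateFn_ne_bot (h : ProperFn φ) (u : Fin n → ℝ) : conjugateFn φ u ≠ ⊥ := by
  obtain ⟨x, hx⟩ := h.2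
  intro hu
  have hle : ((x ⬝ᵥ u : ℝ) : EReal) - φ x ≤ ⊥ :=
    hu ▸ le_iSup (fun x : Fin n → ℝ => ((x ⬝ᵥ u : ℝ) : EReal) - φ x) x
  lift φ x to ℝ using ⟨hx, h.1 x⟩ with r
  rw [← EReal.coe_sub] at hle
  exact EReal.coe_ne_bot _ (le_bot_iff.1 hle)

theorem conjugateFn_le_coe {u : Fin n → ℝ} {c : ℝ}
    (h : ∀ w, ((w ⬝ᵥ u - c : ℝ) : EReal) ≤ φ w) : conjugateFn φ u ≤ c := by
  refine iSup_le fun w => EReal.sub_le_of_le_add ?_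
  calc ((w ⬝ᵥ u : ℝ) : EReal) = c + ((w ⬝ᵥ u - c : ℝ) : EReal) := by
        rw [← EReal.coe_add, add_sub_cancel]
    _ ≤ c + φ w := by gcongr; exact h w

/-- The Fenchel–Young inequality. -/
theorem ProperFn.le_of_conjugateFn_eq (h : ProperFn φ) {u v : Fin n → ℝ} {c : ℝ}
    (hc : conjugateFn φ u = c) : ((v ⬝ᵥ u - c : ℝ) : EReal) ≤ φ v := by
  rcases eq_or_ne (φ v) ⊤ with ht | ht
  · rw [ht]; exact le_top
  have hle : ((v ⬝ᵥ u : ℝ) : EReal) - φ v ≤ c :=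
    hc ▸ le_iSup (fun x : Fin n → ℝ => ((x ⬝ᵥ u : ℝ) : EReal) - φ x) v
  lift φ v to ℝ using ⟨ht, h.1 v⟩ with r
  rw [← EReal.coe_sub, EReal.coe_le_coe_iff] at hle
  rw [EReal.coe_le_coe_iff]
  linarith

end Conjugate

/-! ### Fenchel duality for separable functions -/

section Duality

variable {ι : Type} [Fintype ι] {n : ι → ℕ} {φ : ∀ i, (Fin (n i) → ℝ) → EReal}

/-- The objective `∑ i (⟨b i, u i⟩ - (φ i)*(u i))` of the Fenchel dual of the minimization of
`∑ i, φ i` over the affine space `b + range M`. The dual variable `u` ranges over the annihilator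
of `range M`. -/
noncomputable def dualReward (φ : ∀ i, (Fin (n i) → ℝ) → EReal) (b u : ∀ i, Fin (n i) → ℝ) :
    EReal :=
  ∑ i, (((b i ⬝ᵥ u i : ℝ) : EReal) - conjugateFn (φ i) (u i))

theorem coe_le_dualReward {b u : ∀ i, Fin (n i) → ℝ} {c : ι → ℝ}
    (h : ∀ i, conjugateFn (φ i) (u i) ≤ c i) :
    ((∑ i, (b i ⬝ᵥ u i - c i) : ℝ) : EReal) ≤ dualReward φ b u := by
  rw [ereal_coe_sum]
  refine Finset.sum_le_sum fun i _ => ?_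
  rw [EReal.coe_sub]
  exact EReal.sub_le_sub le_rfl (h i)

/-- The dual reward is `-∞` as soon as one conjugate is `+∞`, since `-∞` absorbs in extended real
sums. -/
theorem dualReward_eq_bot_or {b u : ∀ i, Fin (n i) → ℝ} (hφ : ∀ i, ProperFn (φ i)) :
    dualReward φ b u = ⊥ ∨ ∃ c : ι → ℝ, ∀ i, conjugateFn (φ i) (u i) = c i := by
  by_cases ht : ∃ i, conjugateFn (φ i) (u i) = ⊤
  · obtain ⟨i, hi⟩ := ht
    exact Or.inl (ereal_sum_eq_bot (i := i) (by rw [hi, EReal.sub_top]))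
  · push Not at ht
    exact Or.inr (exists_real_of_forall_ne (fun i => (hφ i).conjugateFn_ne_bot _) ht)

variable {X : Type*} [NormedAddCommGroup X] [NormedSpace ℝ X]

/-- Weak duality. -/
theorem dualReward_le_sum (hφ : ∀ i, ProperFn (φ i)) (M : X →ₗ[ℝ] ∀ i, Fin (n i) → ℝ)
    {b u : ∀ i, Fin (n i) → ℝ} (hu : ∀ x, ∑ i, u i ⬝ᵥ M x i = 0) (x : X) :
    dualReward φ b u ≤ ∑ i, φ i (b i + M x i) := by
  rcases dualReward_eq_bot_or (b := b) (u := u) hφ with h | ⟨c, hc⟩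
  · rw [h]; exact bot_le
  calc dualReward φ b u = ((∑ i, (b i ⬝ᵥ u i - c i) : ℝ) : EReal) := by
        rw [ereal_coe_sum]
        exact Finset.sum_congr rfl fun i _ => by rw [hc, EReal.coe_sub]
    _ = ((∑ i, ((b i + M x i) ⬝ᵥ u i - c i) : ℝ) : EReal) := by
        rw [EReal.coe_eq_coe_iff]
        simp only [add_dotProduct, add_sub_right_comm _ (M x _ ⬝ᵥ _), Finset.sum_add_distrib]
        rw [← Finset.sum_congr rfl fun i _ => dotProduct_comm (u i) (M x i), hu, add_zero]
    _ ≤ ∑ i, φ i (b i + M x i) := by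
        rw [ereal_coe_sum]
        exact Finset.sum_le_sum fun i _ => (hφ i).le_of_conjugateFn_eq (hc i)

variable [FiniteDimensional ℝ X]

/-- Strong duality and attainment when the primal problem is feasible with finite value. -/
theorem exists_dualReward_eq_of_finite (hφ : ∀ i, ProperFn (φ i) ∧ ConvexFn (φ i) ∧ IsPLQ (φ i))
    (M : X →ₗ[ℝ] ∀ i, Fin (n i) → ℝ) (b : ∀ i, Fin (n i) → ℝ) {x₀ : X}
    (hx₀ : ∑ i, φ i (b i + M x₀ i) < ⊤) {m : ℝ} (hm : ∀ x, (m : EReal) ≤ ∑ i, φ i (b i + M x i)) :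
    ∃ x u, (∀ h, ∑ i, u i ⬝ᵥ M h i = 0) ∧ ∑ i, φ i (b i + M x i) ≤ dualReward φ b u := by
  have hbot := fun i => (hφ i).1.1
  obtain ⟨x, r, hr, hmin⟩ := exists_isMin_of_bddBelow (fun i => (hφ i).2.2) M b (m := m)
    ⟨x₀, fun i => lt_top_iff_ne_top.2 fun hi =>
      hx₀.ne (ereal_sum_eq_top (fun i => hbot i _) hi)⟩ fun x r hr => by
        rw [← EReal.coe_le_coe_iff, ereal_coe_sum]
        simpa only [hr] using hm x
  obtain ⟨u, hu, hsub⟩ := exists_subgradient_of_isMin (fun i => (hφ i).2.1) (fun i => (hφ i).2.2)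
    (v := fun i => b i + M x i) hr M fun h s hs => by
      obtain ⟨s', hs'⟩ := exists_real_of_forall_ne (fun i => hbot i (b i + M x i + M h i))
        fun i => ((hs i).trans_lt (EReal.coe_lt_top _)).ne
      refine (hmin (x + h) s' fun i => ?_).trans (Finset.sum_le_sum fun i _ => ?_)
      · rw [← hs', map_add, Pi.add_apply, add_assoc]
      · have := hs i
        rwa [hs', EReal.coe_le_coe_iff] at this
  have hle : ((∑ i, (b i ⬝ᵥ u i - ((b i + M x i) ⬝ᵥ u i - r i)) : ℝ) : EReal) ≤
      dualReward φ b u := coe_le_dualReward fun i => conjugateFn_le_coe fun w => by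
    have := hsub i (w - (b i + M x i))
    rw [add_sub_cancel, dotProduct_sub] at this
    refine le_trans (EReal.coe_le_coe_iff.2 ?_) this
    rw [dotProduct_comm w, dotProduct_comm _ (u i)]
    linarith
  refine ⟨x, u, hu, ?_⟩
  convert hle using 1
  simp only [hr]
  rw [← ereal_coe_sum, EReal.coe_eq_coe_iff]
  have h1 : ∀ i, b i ⬝ᵥ u i - ((b i + M x i) ⬝ᵥ u i - r i) = r i - u i ⬝ᵥ M x i := fun i => by
    rw [add_dotProduct, dotProduct_comm (M x i)]
    ring
  simp only [h1, Finset.sum_sub_distrib, hu, sub_zero]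

/-- If the primal problem is infeasible and the dual problem is feasible, then the dual reward is
unbounded: it grows linearly along a separating functional. -/
theorem exists_le_dualReward_of_infeasible
    (hφ : ∀ i, ProperFn (φ i) ∧ ConvexFn (φ i) ∧ IsPLQ (φ i))
    (M : X →ₗ[ℝ] ∀ i, Fin (n i) → ℝ) (b : ∀ i, Fin (n i) → ℝ)
    (hinf : ∀ x, ∃ i, φ i (b i + M x i) = ⊤) {u₀ : ∀ i, Fin (n i) → ℝ}
    (hu₀ : ∀ h, ∑ i, u₀ i ⬝ᵥ M h i = 0) (hfeas : dualReward φ b u₀ ≠ ⊥) (m : ℝ) :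
    ∃ u, (∀ h, ∑ i, u i ⬝ᵥ M h i = 0) ∧ (m : EReal) ≤ dualReward φ b u := by
  obtain ⟨c, hc⟩ := (dualReward_eq_bot_or fun i => (hφ i).1).resolve_left hfeas
  obtain ⟨u, s, hu, hus, hgap⟩ := exists_separation_of_infeasible (fun i => (hφ i).2.1)
    (fun i => (hφ i).2.2) (fun i => (hφ i).1.2.imp fun _ => lt_top_iff_ne_top.2) M b hinf
  obtain ⟨t, ht0, ht⟩ : ∃ t : ℝ, 0 ≤ t ∧
      m - ∑ i, (b i ⬝ᵥ u₀ i - c i) ≤ t * (∑ i, u i ⬝ᵥ b i - ∑ i, s i) :=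
    ⟨|m - ∑ i, (b i ⬝ᵥ u₀ i - c i)| / (∑ i, u i ⬝ᵥ b i - ∑ i, s i),
      div_nonneg (abs_nonneg _) (sub_pos.2 hgap).le, by
        rw [div_mul_cancel₀ _ (sub_pos.2 hgap).ne']; exact le_abs_self _⟩
  refine ⟨fun i => u₀ i + t • u i, fun h => ?_, ?_⟩
  · simp only [add_dotProduct, smul_dotProduct, Finset.sum_add_distrib, ← Finset.smul_sum, hu₀, hu,
      smul_zero, add_zero]
  · refine le_trans (EReal.coe_le_coe_iff.2 ?_) (coe_le_dualReward (c := fun i => c i + t * s i)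
      fun i => conjugateFn_le_coe fun w => ?_)
    · have h1 : ∀ i, b i ⬝ᵥ (u₀ i + t • u i) - (c i + t * s i) =
          b i ⬝ᵥ u₀ i - c i + t * (u i ⬝ᵥ b i - s i) := fun i => by
        rw [dotProduct_add, dotProduct_smul, dotProduct_comm (u i), smul_eq_mul]
        ring
      simp only [h1]
      rw [Finset.sum_add_distrib, ← Finset.mul_sum,
        Finset.sum_sub_distrib (f := fun i => u i ⬝ᵥ b i)]
      linarith
    · rcases eq_or_ne (φ i w) ⊤ with hw | hw
      · rw [hw]; exact le_top
      refine le_trans (EReal.coe_le_coe_iff.2 ?_) ((hφ i).1.le_of_conjugateFn_eq (hc i))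
      rw [dotProduct_add, dotProduct_smul, dotProduct_comm w (u i), smul_eq_mul]
      have := mul_le_mul_of_nonneg_left (hus i w (lt_top_iff_ne_top.2 hw)) ht0
      linarith

/-- Strong duality for the minimization of a separable convex piecewise linear-quadratic function
over an affine space. -/
theorem iInf_sum_eq_iSup_dualReward (hφ : ∀ i, ProperFn (φ i) ∧ ConvexFn (φ i) ∧ IsPLQ (φ i))
    (M : X →ₗ[ℝ] ∀ i, Fin (n i) → ℝ) (b : ∀ i, Fin (n i) → ℝ)
    (hfeas : (∃ x, ∑ i, φ i (b i + M x i) < ⊤) ∨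
      ∃ u, (∀ h, ∑ i, u i ⬝ᵥ M h i = 0) ∧ ⊥ < dualReward φ b u) :
    (⨅ x, ∑ i, φ i (b i + M x i)) =
        (⨆ (u) (_ : ∀ h, ∑ i, u i ⬝ᵥ M h i = 0), dualReward φ b u) ∧
      ((⨅ x, ∑ i, φ i (b i + M x i)) ≠ ⊥ → (⨅ x, ∑ i, φ i (b i + M x i)) ≠ ⊤ →
        (∃ x, ∑ i, φ i (b i + M x i) = ⨅ x, ∑ i, φ i (b i + M x i)) ∧
        ∃ u, (∀ h, ∑ i, u i ⬝ᵥ M h i = 0) ∧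
          dualReward φ b u = ⨆ (u) (_ : ∀ h, ∑ i, u i ⬝ᵥ M h i = 0), dualReward φ b u) := by
  have hweak : (⨆ (u) (_ : ∀ h, ∑ i, u i ⬝ᵥ M h i = 0), dualReward φ b u) ≤
      ⨅ x, ∑ i, φ i (b i + M x i) :=
    iSup₂_le fun u hu => le_iInf fun x => dualReward_le_sum (fun i => (hφ i).1) M hu x
  set P := ⨅ x, ∑ i, φ i (b i + M x i) with hP
  by_cases hprimal : ∃ x, ∑ i, φ i (b i + M x i) < ⊤
  · obtain ⟨x₀, hx₀⟩ := hprimal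
    have hPtop : P ≠ ⊤ := ((iInf_le _ x₀).trans_lt hx₀).ne
    rcases eq_or_ne P ⊥ with hPbot | hPbot
    · exact ⟨by rw [hPbot] at hweak ⊢; exact (le_bot_iff.1 hweak).symm, fun h => absurd hPbot h⟩
    have hPm : ((P.toReal : ℝ) : EReal) = P := EReal.coe_toReal hPtop hPbot
    obtain ⟨x, u, hu, hle⟩ := exists_dualReward_eq_of_finite hφ M b hx₀ (m := P.toReal)
      fun x => by rw [hPm]; exact iInf_le _ x
    have h1 : P ≤ ∑ i, φ i (b i + M x i) := iInf_le _ x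
    have h2 := le_iSup₂ (f := fun u (_ : ∀ h, ∑ i, u i ⬝ᵥ M h i = 0) => dualReward φ b u) u hu
    have h3 : P = ⨆ (u) (_ : ∀ h, ∑ i, u i ⬝ᵥ M h i = 0), dualReward φ b u :=
      le_antisymm (h1.trans (hle.trans h2)) hweak
    exact ⟨h3, fun _ _ => ⟨⟨x, le_antisymm (hle.trans (h2.trans hweak)) h1⟩, u, hu,
      le_antisymm h2 (h3 ▸ h1.trans hle)⟩⟩
  · obtain ⟨u₀, hu₀, hfeas₀⟩ := hfeas.resolve_left hprimal
    have htop : ∀ x, ∑ i, φ i (b i + M x i) = ⊤ := by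
      simpa only [not_exists, not_lt_top_iff] using hprimal
    have hPtop : P = ⊤ := by rw [hP]; simp only [htop, iInf_const]
    refine ⟨?_, fun _ h => absurd hPtop h⟩
    rw [hPtop, eq_comm, EReal.eq_top_iff_forall_lt]
    intro m
    obtain ⟨u, hu, hle⟩ := exists_le_dualReward_of_infeasible hφ M b (fun x => by
      by_contra! hno
      obtain ⟨r, hr⟩ := exists_real_of_forall_ne (fun i => (hφ i).1.1 (b i + M x i)) hno
      have := htop x
      simp only [hr, ← ereal_coe_sum] at this
      exact EReal.coe_ne_top _ this) hu₀ hfeas₀.ne' (m + 1)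
    exact lt_of_lt_of_le (EReal.coe_lt_coe_iff.2 (lt_add_one m))
      (hle.trans (le_iSup₂ (f := fun u (_ : ∀ h, ∑ i, u i ⬝ᵥ M h i = 0) => dualReward φ b u) u hu))

end Duality

/-! ### Penalties of probability densities -/

section Density

variable {n : ℕ} {φ : (Fin n → ℝ) → EReal}

theorem IsPLQ.measurable (h : IsPLQ φ) : Measurable φ := by
  obtain ⟨k, C, q, hC, hq, hdom, hφq⟩ := h.exists_pieces
  refine measurable_of_Iic fun c => ?_
  rcases eq_or_ne c ⊤ with rfl | hc
  · simp
  have : φ ⁻¹' Set.Iic c = ⋃ i, C i ∩ {x | (q i x : EReal) ≤ c} := by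
    ext x
    simp only [Set.mem_preimage, Set.mem_Iic, Set.mem_iUnion, Set.mem_inter_iff, Set.mem_ofPred_eq]
    constructor
    · intro hx
      obtain ⟨i, hi⟩ := (hdom x).1 (hx.trans_lt (lt_top_iff_ne_top.2 hc))
      exact ⟨i, hi, hφq i x hi ▸ hx⟩
    · rintro ⟨i, hi, hx⟩
      exact (hφq i x hi).trans_le hx
  rw [this]
  exact MeasurableSet.iUnion fun i => (hC i).isClosed.measurableSet.inter
    (measurableSet_le (hq i).continuous.measurable.coe_real_ereal measurable_const)

/-- A log-concave density is bounded. Take a sublevel set of `φ` of positive measure. If `φ` had a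
very small value at `x₀`, then it would be very small on the copy of that set contracted by `1 / 2`
towards `x₀`, whose measure does not depend on `x₀`, and `e^{-φ}` would have too large an
integral. -/
theorem IsDensityPenalty.exists_le (hφ : ConvexFn φ) (hmeas : Measurable φ)
    (h : IsDensityPenalty φ) : ∃ m : ℝ, ∀ x, (m : EReal) ≤ φ x := by
  obtain ⟨h0, htop⟩ := h
  obtain ⟨k, hk⟩ : ∃ k : ℕ, volume {x | φ x ≤ ((k : ℝ) : EReal)} ≠ 0 := by
    by_contra! hno
    refine h0 (lintegral_eq_zero_of_ae_eq_zero ?_)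
    filter_upwards [ae_all_iff.2 fun k : ℕ => measure_eq_zero_iff_ae_notMem.1 (hno k)] with x hx
    have : φ x = ⊤ := by
      rw [EReal.eq_top_iff_forall_lt]
      intro y
      obtain ⟨k, hk⟩ := exists_nat_gt y
      exact (EReal.coe_lt_coe_iff.2 hk).trans (not_le.1 (hx k))
    simp [this]
  set κ := ENNReal.ofReal |(1 / 2 : ℝ) ^ Module.finrank ℝ (Fin n → ℝ)| *
    volume {x | φ x ≤ ((k : ℝ) : EReal)}
  have hκ : κ ≠ 0 := mul_ne_zero (by simp) hk
  set I := ∫⁻ x, EReal.exp (-φ x)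
  by_contra! hno
  have hbound : ∀ N : ℕ, ENNReal.ofReal (N : ℝ) ≤ I / κ := fun N => by
    obtain ⟨x₀, hx₀⟩ := hno (-(2 * N + k))
    have hsub : AffineMap.homothety x₀ (1 / 2 : ℝ) '' {x | φ x ≤ ((k : ℝ) : EReal)} ⊆
        {x | EReal.exp ((N : ℝ) : EReal) ≤ EReal.exp (-φ x)} := by
      rintro _ ⟨x, hx, rfl⟩
      have := hφ.le_segment hx₀.le hx (t := 1 / 2) (by norm_num) (by norm_num)
      refine EReal.exp_monotone (EReal.le_neg_of_le_neg ?_)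
      rw [← EReal.coe_neg]
      convert this using 2
      · simp only [AffineMap.homothety_apply, vsub_eq_sub, vadd_eq_add]
        module
      · ring
    have h1 : EReal.exp ((N : ℝ) : EReal) * κ ≤ I :=
      calc _ = EReal.exp ((N : ℝ) : EReal) * volume
            (AffineMap.homothety x₀ (1 / 2 : ℝ) '' {x | φ x ≤ ((k : ℝ) : EReal)}) := by
            rw [Measure.addHaar_image_homothety]
        _ ≤ _ := mul_le_mul_right (measure_mono hsub) _
        _ ≤ I := mul_meas_ge_le_lintegral (EReal.measurable_exp.comp hmeas.neg) _
    rw [ENNReal.le_div_iff_mul_le (Or.inl hκ) (Or.inr htop)]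
    refine le_trans (mul_le_mul_left ?_ _) h1
    rw [EReal.exp_coe]
    exact ENNReal.ofReal_le_ofReal (by linarith [Real.add_one_le_exp (N : ℝ)])
  obtain ⟨N, hN⟩ := ENNReal.exists_nat_gt (ENNReal.div_lt_top htop hκ).ne
  exact absurd (hbound N) (by simpa using hN)

end Density

/-! ### The estimation and control problems as a Fenchel pair -/

namespace EstimationData

variable {T nx nz : ℕ} (S : EstimationData T nx nz)

/-- Dimensions of the arguments of the penalties: the index `Sum.inl t` belongs to `f t` and
`Sum.inr t` to `g t`. -/
abbrev blockDim (T nx nz : ℕ) : Fin (T + 1) ⊕ Fin (T + 1) → ℕ :=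
  Sum.elim (fun _ => nx) fun _ => nz

/-- The family of all penalties of both kinds. -/
def blockPenalty : ∀ i, (Fin (blockDim T nx nz i) → ℝ) → EReal
  | .inl t => S.f t
  | .inr t => S.g t

/-- The value of the penalties' arguments at `x = 0`. -/
def blockOffset : ∀ i, Fin (blockDim T nx nz i) → ℝ
  | .inl _ => 0
  | .inr t => S.z t

/-- A pair of families of vectors, as a single family. -/
def blockPair (w : Fin (T + 1) → Fin nx → ℝ) (e : Fin (T + 1) → Fin nz → ℝ) :
    ∀ i, Fin (blockDim T nx nz i) → ℝ
  | .inl t => w t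
  | .inr t => e t

/-- The dynamical noise that produces the trajectory `x`, as a function of `x`. -/
def noise (x : Fin (T + 1) → Fin nx → ℝ) : Fin (T + 1) → Fin nx → ℝ :=
  Fin.cons (x 0) fun t : Fin T => x t.succ - S.F t *ᵥ x t.castSucc

theorem noise_add (x x' : Fin (T + 1) → Fin nx → ℝ) :
    S.noise (x + x') = S.noise x + S.noise x' := by
  funext t
  refine Fin.cases ?_ (fun t => ?_) t
  · rfl
  · simp only [noise, Pi.add_apply, Fin.cons_succ, mulVec_add]
    abel

theorem noise_smul (c : ℝ) (x : Fin (T + 1) → Fin nx → ℝ) : S.noise (c • x) = c • S.noise x := by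
  funext t
  refine Fin.cases ?_ (fun t => ?_) t
  · rfl
  · simp only [noise, Pi.smul_apply, Fin.cons_succ, mulVec_smul, smul_sub]

/-- The linear part of the dependence of the penalties' arguments on the trajectory `x`. -/
def blockMap : (Fin (T + 1) → Fin nx → ℝ) →ₗ[ℝ] ∀ i, Fin (blockDim T nx nz i) → ℝ where
  toFun x := blockPair (S.noise x) fun t => -(S.H t *ᵥ x t)
  map_add' x x' := by
    funext i
    rcases i with t | t
    · exact congrFun (S.noise_add x x') t
    · change -(S.H t *ᵥ (x t + x' t)) = -(S.H t *ᵥ x t) + -(S.H t *ᵥ x' t)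
      rw [mulVec_add, neg_add]
  map_smul' c x := by
    funext i
    rcases i with t | t
    · exact congrFun (S.noise_smul c x) t
    · change -(S.H t *ᵥ (c • x t)) = c • -(S.H t *ᵥ x t)
      rw [mulVec_smul, smul_neg]

theorem stateEq_iff {x w : Fin (T + 1) → Fin nx → ℝ} : S.StateEq x w ↔ w = S.noise x := by
  rw [StateEq, funext_iff (f := w), Fin.forall_fin_succ (P := fun t => w t = S.noise x t)]
  refine and_congr ?_ (forall_congr' fun t => ?_)
  · simp [noise, eq_comm]
  · simp [noise, eq_sub_iff_add_eq', eq_comm]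

theorem estimationCost_noise (x : Fin (T + 1) → Fin nx → ℝ) :
    S.estimationCost x (S.noise x) =
      ∑ i, S.blockPenalty i (S.blockOffset i + S.blockMap x i) := by
  rw [Fintype.sum_sum_type, estimationCost]
  refine congrArg₂ _ (Finset.sum_congr rfl fun t _ => ?_) (Finset.sum_congr rfl fun t _ => ?_)
  · exact congrArg (S.f t) (zero_add _).symm
  · exact congrArg (S.g t) (sub_eq_add_neg _ _)

theorem estimationValue_eq : S.estimationValue =
    ⨅ x, ∑ i, S.blockPenalty i (S.blockOffset i + S.blockMap x i) := by
  simp only [estimationValue, stateEq_iff, iInf_iInf_eq_left, estimationCost_noise]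

theorem estimationFeasible_iff : S.EstimationFeasible ↔
    ∃ x, ∑ i, S.blockPenalty i (S.blockOffset i + S.blockMap x i) < ⊤ := by
  simp only [EstimationFeasible, stateEq_iff, exists_eq_left, estimationCost_noise]

theorem estimationAttained_iff : S.EstimationAttained ↔
    ∃ x, ∑ i, S.blockPenalty i (S.blockOffset i + S.blockMap x i) = S.estimationValue := by
  simp only [EstimationAttained, stateEq_iff, exists_eq_left, estimationCost_noise]

/-- The residual of the backward equations. -/
def adjointResidual (y : Fin (T + 1) → Fin nx → ℝ) (u : Fin (T + 1) → Fin nz → ℝ) :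
    Fin (T + 1) → Fin nx → ℝ :=
  Fin.snoc (α := fun _ => Fin nx → ℝ)
    (fun t : Fin T => y t.castSucc - ((S.F t)ᵀ *ᵥ y t.succ + (S.H t.castSucc)ᵀ *ᵥ u t.castSucc))
    (y (Fin.last T) - (S.H (Fin.last T))ᵀ *ᵥ u (Fin.last T))

theorem adjointEq_iff {y : Fin (T + 1) → Fin nx → ℝ} {u : Fin (T + 1) → Fin nz → ℝ} :
    S.AdjointEq y u ↔ S.adjointResidual y u = 0 := by
  rw [AdjointEq, funext_iff (f := S.adjointResidual y u),
    Fin.forall_fin_succ' (P := fun t => S.adjointResidual y u t = (0 : Fin (T + 1) → Fin nx → ℝ) t),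
    and_comm]
  simp [adjointResidual, sub_eq_zero]

/-- Summation by parts along the trajectory: the backward equations are the adjoint of the state
equations. -/
theorem sum_blockPair_dotProduct_blockMap (x y : Fin (T + 1) → Fin nx → ℝ)
    (u : Fin (T + 1) → Fin nz → ℝ) :
    ∑ i, blockPair y u i ⬝ᵥ S.blockMap x i = ∑ t, S.adjointResidual y u t ⬝ᵥ x t := by
  have h1 : ∑ t, y t ⬝ᵥ S.noise x t =
      ∑ t, y t ⬝ᵥ x t - ∑ t : Fin T, ((S.F t)ᵀ *ᵥ y t.succ) ⬝ᵥ x t.castSucc := by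
    rw [Fin.sum_univ_succ, Fin.sum_univ_succ (fun t => y t ⬝ᵥ x t)]
    simp only [noise, Fin.cons_zero, Fin.cons_succ, dotProduct_sub, Finset.sum_sub_distrib,
      mulVec_transpose, dotProduct_mulVec]
    ring
  have h2 : ∀ t, u t ⬝ᵥ -(S.H t *ᵥ x t) = -(((S.H t)ᵀ *ᵥ u t) ⬝ᵥ x t) := fun t => by
    rw [dotProduct_neg, mulVec_transpose, dotProduct_mulVec]
  calc ∑ i, blockPair y u i ⬝ᵥ S.blockMap x i
      = ∑ t, y t ⬝ᵥ S.noise x t + ∑ t, u t ⬝ᵥ -(S.H t *ᵥ x t) := Fintype.sum_sum_type _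
    _ = ∑ t, S.adjointResidual y u t ⬝ᵥ x t := by
      simp only [h1, h2]
      rw [Fin.sum_univ_castSucc, Fin.sum_univ_castSucc (fun t => -_),
        Fin.sum_univ_castSucc (fun t => S.adjointResidual y u t ⬝ᵥ x t)]
      simp only [adjointResidual, Fin.snoc_castSucc, Fin.snoc_last, sub_dotProduct, add_dotProduct,
        Finset.sum_sub_distrib, Finset.sum_add_distrib, Finset.sum_neg_distrib]
      ring

theorem adjointEq_iff_annihilates {y : Fin (T + 1) → Fin nx → ℝ} {u : Fin (T + 1) → Fin nz → ℝ} :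
    S.AdjointEq y u ↔ ∀ x, ∑ i, blockPair y u i ⬝ᵥ S.blockMap x i = 0 := by
  simp only [sum_blockPair_dotProduct_blockMap, adjointEq_iff]
  constructor
  · intro h x
    simp [h]
  · intro h
    funext t
    -- testing against the residual itself makes its squared norm vanish
    have h1 := h (S.adjointResidual y u)
    have h2 := (Finset.sum_eq_zero_iff_of_nonneg
      (f := fun t => S.adjointResidual y u t ⬝ᵥ S.adjointResidual y u t)
      fun t _ => Finset.sum_nonneg fun k _ => mul_self_nonneg _).1 h1 t (Finset.mem_univ t)
    exact dotProduct_self_eq_zero.1 h2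

theorem controlReward_eq (y : Fin (T + 1) → Fin nx → ℝ) (u : Fin (T + 1) → Fin nz → ℝ) :
    S.controlReward y u = dualReward S.blockPenalty S.blockOffset (blockPair y u) := by
  rw [controlReward, dualReward, Fintype.sum_sum_type, ← Finset.sum_add_distrib]
  refine Finset.sum_congr rfl fun t _ => ?_
  change _ = (((0 : Fin nx → ℝ) ⬝ᵥ y t : ℝ) : EReal) - conjugateFn (S.f t) (y t) +
    (((S.z t ⬝ᵥ u t : ℝ) : EReal) - conjugateFn (S.g t) (u t))
  rw [zero_dotProduct, EReal.coe_zero, zero_sub, sub_eq_add_neg, sub_eq_add_neg, sub_eq_add_neg,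
    add_assoc, add_left_comm]

theorem blockPair_surjective (v : ∀ i, Fin (blockDim T nx nz i) → ℝ) :
    ∃ y u, blockPair (T := T) (nx := nx) (nz := nz) y u = v :=
  ⟨fun t => v (.inl t), fun t => v (.inr t), by funext i; rcases i with t | t <;> rfl⟩

theorem controlFeasible_iff : S.ControlFeasible ↔
    ∃ v, (∀ x, ∑ i, v i ⬝ᵥ S.blockMap x i = 0) ∧
      ⊥ < dualReward S.blockPenalty S.blockOffset v := by
  simp only [ControlFeasible, adjointEq_iff_annihilates, controlReward_eq]
  constructor
  · rintro ⟨y, u, h⟩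
    exact ⟨_, h⟩
  · rintro ⟨v, h⟩
    obtain ⟨y, u, rfl⟩ := blockPair_surjective v
    exact ⟨y, u, h⟩

theorem controlValue_eq : S.controlValue =
    ⨆ (v) (_ : ∀ x, ∑ i, v i ⬝ᵥ S.blockMap x i = 0),
      dualReward S.blockPenalty S.blockOffset v := by
  simp only [controlValue, adjointEq_iff_annihilates, controlReward_eq]
  refine le_antisymm (iSup_le fun y => iSup₂_le fun u h => le_iSup₂_of_le (blockPair y u) h le_rfl)
    (iSup₂_le fun v h => ?_)
  obtain ⟨y, u, rfl⟩ := blockPair_surjective v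
  exact le_iSup_of_le y (le_iSup₂_of_le u h le_rfl)

theorem controlAttained_iff : S.ControlAttained ↔
    ∃ v, (∀ x, ∑ i, v i ⬝ᵥ S.blockMap x i = 0) ∧
      dualReward S.blockPenalty S.blockOffset v = S.controlValue := by
  simp only [ControlAttained, adjointEq_iff_annihilates, controlReward_eq]
  constructor
  · rintro ⟨y, u, h⟩
    exact ⟨_, h⟩
  · rintro ⟨v, h⟩
    obtain ⟨y, u, rfl⟩ := blockPair_surjective v
    exact ⟨y, u, h⟩

end EstimationData

/-! ### Strong duality -/

theorem mainTheorem3 {T nx nz : ℕ} (S : EstimationData T nx nz)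
    (hf : ∀ t, ProperFn (S.f t) ∧ ConvexFn (S.f t) ∧ IsPLQ (S.f t))
    (hg : ∀ t, ProperFn (S.g t) ∧ ConvexFn (S.g t) ∧ IsPLQ (S.g t))
    (hfeas : S.EstimationFeasible ∨ S.ControlFeasible) :
    S.estimationValue = S.controlValue ∧
    (S.estimationValue ≠ ⊥ → S.estimationValue ≠ ⊤ →
      S.EstimationAttained ∧ S.ControlAttained) ∧
    ((∀ t, IsDensityPenalty (S.f t)) → (∀ t, IsDensityPenalty (S.g t)) →
      S.EstimationFeasible →
        S.estimationValue ≠ ⊥ ∧ S.estimationValue ≠ ⊤ ∧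
          S.EstimationAttained ∧ S.ControlAttained) := by
  have hφ : ∀ i, ProperFn (S.blockPenalty i) ∧ ConvexFn (S.blockPenalty i) ∧
      IsPLQ (S.blockPenalty i) := by
    rintro (t | t)
    · exact hf t
    · exact hg t
  have hdual := iInf_sum_eq_iSup_dualReward hφ S.blockMap S.blockOffset
    (hfeas.imp S.estimationFeasible_iff.1 S.controlFeasible_iff.1)
  rw [← S.estimationValue_eq, ← S.controlValue_eq, ← S.estimationAttained_iff,
    ← S.controlAttained_iff] at hdual
  refine ⟨hdual.1, hdual.2, fun hdf hdg hP => ?_⟩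
  have htop : S.estimationValue ≠ ⊤ := by
    obtain ⟨x, hx⟩ := S.estimationFeasible_iff.1 hP
    rw [S.estimationValue_eq]
    exact ((iInf_le _ x).trans_lt hx).ne
  have hbot : S.estimationValue ≠ ⊥ := by
    have hbdd : ∀ i, ∃ m : ℝ, ∀ w, (m : EReal) ≤ S.blockPenalty i w := by
      rintro (t | t)
      · exact (hdf t).exists_le (hf t).2.1 (hf t).2.2.measurable
      · exact (hdg t).exists_le (hg t).2.1 (hg t).2.2.measurable
    choose m hm using hbdd
    refine ne_bot_of_le_ne_bot (EReal.coe_ne_bot (∑ i, m i)) ?_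
    rw [S.estimationValue_eq, ereal_coe_sum]
    exact le_iInf fun x => Finset.sum_le_sum fun i _ => hm i _
  exact ⟨hbot, htop, hdual.2 hbot htop⟩
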